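/- Work in a countably saturated nonstandard universe (transfer holds, and every sequence of internal sets with the finite intersection property has nonempty intersection). Let $d\in\mathbb{N}$. For an internal hyperfinite nonempty $B\subseteq{}^{*}\mathbb{Z}^d$ let $\mu_B$ be the Loeb measure on $B$, that is, the countably additive probability measure extending $D\mapsto \operatorname{st}(|D|/|B|)$ ($D\subseteq B$ internal); for sets $S$ not contained in $B$ write $\mu_B(S)=\mu_B(S\cap B)$. For an internal set $E\subseteq{}^{*}\mathbb{Z}^d$ and $x\in{}^{*}\mathbb{Z}^d$ put $$d_E(x)=\sup_{H>\mathbb{N}}\ \inf_{\mathbb{N}<\nu<H}\ \mu_{x+[-\nu,\nu]^d}\big((E+\mathbb{Z}^d)\cap(x+[-\nu,\nu]^d)\big),$$ where $H,\nu$ range over the infinite hypernatural numbers. Call $x$ a point of density of $E$ if $d_E(x)=1$, and a point of syndeticity of $E$ if there is a finite (standard) natural number $m$ with $x+\mathbb{Z}^d\subseteq E+[-m,m]^d$. Theorem. Let $X,Y$ be internal subsets of ${}^{*}\mathbb{Z}^d$ and $a,b\in{}^{*}\mathbb{Z}^d$. If $d_X(a)=1$ and $d_Y(b)=1$, then $a+b$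 is a point of syndeticity of $X+Y$, i.e. there is $m\in\mathbb{N}$ with $a+b+\mathbb{Z}^d\subseteq X+Y+[-m,m]^d$. -/

import Mathlib

open scoped Pointwise ENNReal

universe u

noncomputable section

namespace NSA

/-! ### The standard objects and their nonstandard extension -/

/-- The standard objects: natural numbers, real numbers, points of `ℤ^d` and arbitrary subsets of
`ℤ^d`, for all `d`. -/
inductive Obj : Type
  | nat (n : ℕ) : Obj
  | real (r : ℝ) : Obj
  | point (d : ℕ) (x : Fin d → ℤ) : Obj
  | set (d : ℕ) (A : Set (Fin d → ℤ)) : Obj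

/-- The full first-order language over the standard objects: every finitary function on them and
every finitary relation between them has a symbol. In particular each standard object has a name,
as a function of no arguments. -/
def fullLanguage : FirstOrder.Language.{0, 0} where
  Functions n := (Fin n → Obj) → Obj
  Relations n := Set (Fin n → Obj)

/-- The standard interpretation: every symbol denotes itself. -/
instance : fullLanguage.Structure Obj where
  funMap f v := f v
  RelMap R v := (show Set (Fin _ → Obj) from R) v

/-- The transfer principle: `M` interprets all the symbols of the full language, and the same
first-order sentences hold in `M` as for the standard objects. So `M` is the nonstandard extension
`*Obj` of the set of standard objects, as found in any nonstandard universe, the interpretation in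
`M` of a symbol being the nonstandard extension of the function or relation that it stands for. -/
class NonstandardExtension (M : Type u) [fullLanguage.Structure M] : Prop where
  transfer : fullLanguage.ElementarilyEquivalent Obj M

/-- The sorts of standard objects. -/
class StdSort (α : Type) where
  code : α → Obj
  code_injective : Function.Injective code

instance : StdSort ℕ := ⟨Obj.nat, fun _ _ h => by injection h⟩
instance : StdSort ℝ := ⟨Obj.real, fun _ _ h => by injection h⟩
instance (d : ℕ) : StdSort (Fin d → ℤ) := ⟨Obj.point d, fun _ _ h => by injection h⟩
instance (d : ℕ) : StdSort (Set (Fin d → ℤ)) := ⟨Obj.set d, fun _ _ h => by injection h⟩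

section Symbols

variable {α β γ : Type} [StdSort α] [StdSort β] [StdSort γ]

/-- The predicate of being of sort `α`. -/
def sortSymb (α : Type) [StdSort α] : fullLanguage.Relations 1 :=
  {v : Fin 1 → Obj | ∃ a : α, v 0 = StdSort.code a}

/-- A relation between objects of sorts `α` and `β`. -/
def relSymb (R : α → β → Prop) : fullLanguage.Relations 2 :=
  {v : Fin 2 → Obj | ∃ (a : α) (b : β), v 0 = StdSort.code a ∧ v 1 = StdSort.code b ∧ R a b}

/-- The name of an object of sort `α`. -/
def constSymb (a : α) : fullLanguage.Functions 0 := fun _ : Fin 0 → Obj => StdSort.code a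

open Classical in
/-- A function from `α` to `β`, continued by a junk value to objects of other sorts. -/
def funSymb₁ (f : α → β) : fullLanguage.Functions 1 := fun v : Fin 1 → Obj =>
  if h : ∃ a : α, v 0 = StdSort.code a then StdSort.code (f h.choose) else v 0

open Classical in
/-- A function from `α × β` to `γ`, continued by a junk value to objects of other sorts. -/
def funSymb₂ (f : α → β → γ) : fullLanguage.Functions 2 := fun v : Fin 2 → Obj =>
  if h : ∃ p : α × β, v 0 = StdSort.code p.1 ∧ v 1 = StdSort.code p.2 then
    StdSort.code (f h.choose.1 h.choose.2) else v 0

open FirstOrder FirstOrder.Language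

/-- The sentence saying that the function `f` maps the product of the predicates `P i` into `Q`. -/
def mapsSentence {n : ℕ} (P : Fin n → fullLanguage.Relations 1) (Q : fullLanguage.Relations 1)
    (f : fullLanguage.Functions n) : fullLanguage.Sentence :=
  (BoundedFormula.iInf (fun i => (P i).boundedFormula
      ![(Term.var (Sum.inr i) : fullLanguage.Term (Empty ⊕ Fin n))]) ⟹
    Q.boundedFormula ![Term.func f fun i => Term.var (Sum.inr i)]).alls

theorem realize_mapsSentence {n : ℕ} (P : Fin n → fullLanguage.Relations 1)
    (Q : fullLanguage.Relations 1) (f : fullLanguage.Functions n)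
    (N : Type u) [fullLanguage.Structure N] :
    N ⊨ mapsSentence P Q f ↔ ∀ x : Fin n → N, (∀ i, Structure.RelMap (P i) ![x i]) →
      Structure.RelMap Q ![Structure.funMap f x] := by
  have e (t : fullLanguage.Term (Empty ⊕ Fin n)) (w : Empty ⊕ Fin n → N) :
      (fun i => (![t] i).realize w) = ![t.realize w] := by
    funext i
    fin_cases i
    rfl
  rw [Sentence.Realize, mapsSentence, BoundedFormula.realize_alls]
  simp only [BoundedFormula.realize_imp, BoundedFormula.realize_iInf,
    BoundedFormula.realize_rel, e]
  rfl

variable (M : Type u) [fullLanguage.Structure M] [hM : NonstandardExtension M]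

theorem transfer_maps {n : ℕ} (P : Fin n → fullLanguage.Relations 1)
    (Q : fullLanguage.Relations 1) (f : fullLanguage.Functions n)
    (h : ∀ x : Fin n → Obj, (∀ i, Structure.RelMap (P i) ![x i]) →
      Structure.RelMap Q ![Structure.funMap f x]) (x : Fin n → M)
    (hx : ∀ i, Structure.RelMap (P i) ![x i]) : Structure.RelMap Q ![Structure.funMap f x] :=
  (realize_mapsSentence P Q f M).1 ((hM.transfer.realize_sentence _).1
    ((realize_mapsSentence P Q f Obj).2 h)) x hx

theorem sortSymb_constSymb (a : α) :
    Structure.RelMap (sortSymb α) ![Structure.funMap (constSymb a) (![] : Fin 0 → M)] :=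
  transfer_maps M ![] (sortSymb α) (constSymb a) (fun _ _ => ⟨a, rfl⟩) ![] fun i => i.elim0

theorem sortSymb_funSymb₁ (f : α → β) (x : M) (hx : Structure.RelMap (sortSymb α) ![x]) :
    Structure.RelMap (sortSymb β) ![Structure.funMap (funSymb₁ f) ![x] ] := by
  refine transfer_maps M ![sortSymb α] (sortSymb β) (funSymb₁ f) (fun y hy => ?_) ![x]
    fun i => by fin_cases i; exact hx
  have h : ∃ a : α, y 0 = StdSort.code a := hy 0
  exact ⟨f h.choose, dif_pos h⟩

theorem sortSymb_funSymb₂ (f : α → β → γ) (x y : M)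
    (hx : Structure.RelMap (sortSymb α) ![x]) (hy : Structure.RelMap (sortSymb β) ![y]) :
    Structure.RelMap (sortSymb γ) ![Structure.funMap (funSymb₂ f) ![x, y] ] := by
  refine transfer_maps M ![sortSymb α, sortSymb β] (sortSymb γ) (funSymb₂ f) (fun z hz => ?_)
    ![x, y] fun i => by fin_cases i <;> assumption
  have h : ∃ p : α × β, z 0 = StdSort.code p.1 ∧ z 1 = StdSort.code p.2 := by
    obtain ⟨a, ha⟩ := hz 0
    obtain ⟨b, hb⟩ := hz 1
    exact ⟨(a, b), ha, hb⟩
  exact ⟨f h.choose.1 h.choose.2, dif_pos h⟩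

end Symbols

section Star

variable (M : Type u) [fullLanguage.Structure M]
variable {α β γ : Type} [StdSort α] [StdSort β] [StdSort γ]

/-- The nonstandard extension `*α` of `α`: the elements of `M` of sort `α`. -/
@[ext]
structure Star (α : Type) [StdSort α] : Type u where
  val : M
  property : FirstOrder.Language.Structure.RelMap (sortSymb α) ![val]

/-- The canonical map `α → *α`; its range is the set of standard elements of `*α`. -/
def Star.std [NonstandardExtension M] (a : α) : Star M α :=
  ⟨_, sortSymb_constSymb M a⟩

variable {M}

/-- The nonstandard extension `*f : *α → *β` of a function `f : α → β`. -/
def Star.map [NonstandardExtension M] (f : α → β) (x : Star M α) : Star M β :=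
  ⟨_, sortSymb_funSymb₁ M f x.val x.property⟩

/-- The nonstandard extension `*f : *α × *β → *γ` of a function `f : α × β → γ`. -/
def Star.map₂ [NonstandardExtension M] (f : α → β → γ) (x : Star M α) (y : Star M β) :
    Star M γ :=
  ⟨_, sortSymb_funSymb₂ M f x.val y.val x.property y.property⟩

/-- The nonstandard extension `*R` of a relation `R` between `α` and `β`. -/
def Star.rel (R : α → β → Prop) (x : Star M α) (y : Star M β) : Prop :=
  FirstOrder.Language.Structure.RelMap (relSymb R) ![x.val, y.val]

instance [NonstandardExtension M] [Add α] : Add (Star M α) := ⟨Star.map₂ (· + ·)⟩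
instance [NonstandardExtension M] [Div α] : Div (Star M α) := ⟨Star.map₂ (· / ·)⟩
instance : LT (Star M ℕ) := ⟨Star.rel (· < ·)⟩
instance : LE (Star M ℝ) := ⟨Star.rel (· ≤ ·)⟩

end Star

/-! ### Internal sets, saturation, Loeb measure -/

variable {M : Type u} [fullLanguage.Structure M] {d : ℕ}

/-- The set of all `x ∈ *(ℤ^d)` with `x *∈ A`, for an element `A` of `*P(ℤ^d)`. -/
def Star.extent (A : Star M (Set (Fin d → ℤ))) : Set (Star M (Fin d → ℤ)) :=
  {x | Star.rel (fun (y : Fin d → ℤ) (B : Set (Fin d → ℤ)) => y ∈ B) x A}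

/-- A subset of `*(ℤ^d)` is internal if it is given by an element of `*P(ℤ^d)`. -/
def IsInternal (S : Set (Star M (Fin d → ℤ))) : Prop :=
  ∃ A : Star M (Set (Fin d → ℤ)), S = A.extent

variable (M) in
/-- Countable saturation: a sequence of internal subsets of `*(ℤ^k)` with the finite intersection
property has
nonempty intersection. -/
def CountablySaturated : Prop :=
  ∀ (k : ℕ) (S : ℕ → Set (Star M (Fin k → ℤ))), (∀ n, IsInternal (S n)) →
    (∀ n, (⋂ i ≤ n, S i).Nonempty) → (⋂ i, S i).Nonempty

variable [NonstandardExtension M]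

variable (M d) in
/-- The standard lattice `ℤ^d`, as a subset of `*(ℤ^d)`. -/
def stdLattice : Set (Star M (Fin d → ℤ)) := Set.range (Star.std M)

/-- A hypernatural number is infinite if it exceeds every standard natural number. -/
def Infinite (ν : Star M ℕ) : Prop := ∀ n : ℕ, Star.std M n < ν

variable (d) in
/-- The cube `[-ν, ν]^d` in `*(ℤ^d)`. -/
def cube (ν : Star M ℕ) : Set (Star M (Fin d → ℤ)) :=
  {x | Star.rel (fun (y : Fin d → ℤ) (n : ℕ) => ∀ i, -(n : ℤ) ≤ y i ∧ y i ≤ n) x ν}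

open Classical in
/-- The internal cardinality `|S|` of a hyperfinite internal set `S`, as a hyperreal number. -/
def hcard (S : Set (Star M (Fin d → ℤ))) : Star M ℝ :=
  if h : IsInternal S then
    Star.map (fun A : Set (Fin d → ℤ) => (A.ncard : ℝ)) h.choose
  else Star.std M (0 : ℝ)

/-- The standard part of a finite hyperreal number. -/
def stdPart (x : Star M ℝ) : ℝ := sSup {r : ℝ | Star.std M r ≤ x}

/-- The Loeb outer measure on a hyperfinite internal set `B`: the outer measure generated by the
finitely additive measure `D ↦ st (|D| / |B|)` on the internal subsets `D` of `B`. -/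
def loebOuter (B : Set (Star M (Fin d → ℤ))) : MeasureTheory.OuterMeasure B :=
  MeasureTheory.OuterMeasure.boundedBy fun D : Set B =>
    ⨅ _ : IsInternal (Subtype.val '' D),
      ENNReal.ofReal (stdPart (hcard (Subtype.val '' D) / hcard B))

/-- The Loeb measure on a hyperfinite internal set `B`, on the `σ`-algebra of Loeb measurable
subsets of `B` (those which are measurable in the sense of Carathéodory). -/
def loebMeasure (B : Set (Star M (Fin d → ℤ))) :
    @MeasureTheory.Measure B (loebOuter B).caratheodory :=
  @MeasureTheory.OuterMeasure.toMeasure B (loebOuter B).caratheodory (loebOuter B) le_rfl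

/-- The Loeb measure `μ_B(S) = μ_B(S ∩ B)` of a set `S` relative to `B`. -/
def loeb (B S : Set (Star M (Fin d → ℤ))) : ℝ≥0∞ :=
  loebMeasure B (Subtype.val ⁻¹' S : Set B)

/-! ### Points of density and points of syndeticity -/

/-- `d_E(x)`, the supremum over infinite `H` of the infimum over infinite `ν < H` of
`μ_{x + [-ν, ν]^d} (E + ℤ^d)`. -/
def densityAt (E : Set (Star M (Fin d → ℤ))) (x : Star M (Fin d → ℤ)) : ℝ≥0∞ :=
  ⨆ (H : Star M ℕ) (_ : Infinite H), ⨅ (ν : Star M ℕ) (_ : Infinite ν ∧ ν < H),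
    loeb ({x} + cube d ν) (E + stdLattice M d)

/-- `x` is a point of density of `E`. -/
def IsPointOfDensity (E : Set (Star M (Fin d → ℤ))) (x : Star M (Fin d → ℤ)) : Prop :=
  densityAt E x = 1

/-- `x` is a point of syndeticity of `E`. -/
def IsPointOfSyndeticity (E : Set (Star M (Fin d → ℤ))) (x : Star M (Fin d → ℤ)) : Prop :=
  ∃ m : ℕ, {x} + stdLattice M d ⊆ E + cube d (Star.std M m)

end NSA

end

/-! Density forces syndeticity by pigeonhole, and density above 1/2 at one common infinite radius is
enough. Since `X + ℤ^d` is the increasing union of the internal sets `X + [-m, m]^d` over standard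
`m`, continuity of the Loeb measure from below yields a standard `m` for which `X + [-m, m]^d`
already fills more than half of `a + [-ν, ν]^d`, by a standard margin. Likewise some `Y + [-k, k]^d`
fills more than half of `b + [-ν, ν]^d`, with the same `ν` taken below both witnesses of density
(`exists_infinite_lt_lt`).

For standard `z`, reflect the second set to `a + b + z - (Y + [-k, k]^d)`. Both sets then have large
parts in a box about `a` whose radius exceeds `ν` by a standard amount only, so its volume is `[-ν,
ν]^d` up to an infinitesimal relative error. The two parts must meet, and `a + b + z` lies in `X + Y
+ [-(m + k), m + k]^d`, where `m + k` does not depend on `z`. The counting is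
`eventually_mem_add_of_dense`; the passage from Loeb measure to counting is
`IsPointOfDensity.exists_infinite`.

Transfer is used in ultrapower form. A finite tuple of nonstandard elements determines an
ultrafilter on standard tuples, its entries are represented by standard functions, and atomic
relations between represented elements hold exactly when they hold eventually along the ultrafilter.
-/

namespace NSA

open FirstOrder FirstOrder.Language Filter

/-! ### Transfer as Łoś's theorem over the ultrafilter of a tuple -/

section Transfer

variable {M : Type u} [fullLanguage.Structure M] [hM : NonstandardExtension M] {n k : ℕ}

theorem realize_of_forall_obj (φ : fullLanguage.BoundedFormula Empty n)
    (h : ∀ v : Fin n → Obj, φ.Realize default v) (v : Fin n → M) : φ.Realize default v := by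
  have key := (hM.transfer.realize_sentence φ.alls).1
    ((BoundedFormula.realize_alls (φ := φ) (v := default)).2 h)
  exact (BoundedFormula.realize_alls (φ := φ) (v := default)).1 key v

/-- The term applying the function symbol `f` to all the variables. -/
def appTerm (f : (Fin n → Obj) → Obj) : fullLanguage.Term (Empty ⊕ Fin n) :=
  Term.func (l := n) f fun j => Term.var (Sum.inr j)

/-- The formula applying the relation symbol `R` to all the variables. -/
def appFormula (R : Set (Fin n → Obj)) : fullLanguage.BoundedFormula Empty n :=
  Relations.boundedFormula (n := n) (show fullLanguage.Relations n from R)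
    fun j => Term.var (Sum.inr j)

theorem realize_appFormula {N : Type*} [fullLanguage.Structure N] (R : Set (Fin n → Obj))
    (e : Empty → N) (v : Fin n → N) :
    (appFormula R).Realize e v ↔ Structure.RelMap (L := fullLanguage) (n := n) R v := by
  rw [appFormula, BoundedFormula.realize_rel]
  rfl

/-- The equivalence is tautological for standard tuples, so it transfers. Because every relation has
a symbol, a composite condition on a tuple collapses to a single symbol applied to that tuple. -/
theorem relMap_comp (R : Set (Fin k → Obj)) (f : Fin k → (Fin n → Obj) → Obj) (x : Fin n → M) :
    Structure.RelMap (L := fullLanguage) (n := k) R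
        (fun i => Structure.funMap (L := fullLanguage) (n := n) (f i) x) ↔
      Structure.RelMap (L := fullLanguage) (n := n) {o | (fun i => f i o) ∈ R} x := by
  have h := realize_of_forall_obj (M := M) (n := n)
    ((Relations.boundedFormula (n := k) (show fullLanguage.Relations k from R)
      fun i => appTerm (f i)).iff (appFormula {o | (fun i => f i o) ∈ R})) (fun v => by
      rw [BoundedFormula.realize_iff, realize_appFormula, BoundedFormula.realize_rel]
      rfl) x
  rw [BoundedFormula.realize_iff, realize_appFormula, BoundedFormula.realize_rel] at h
  exact h

theorem relMap_inter (R S : Set (Fin n → Obj)) (x : Fin n → M) :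
    Structure.RelMap (L := fullLanguage) (n := n) (R ∩ S : Set _) x ↔
      Structure.RelMap (L := fullLanguage) (n := n) R x ∧
        Structure.RelMap (L := fullLanguage) (n := n) S x := by
  have h := realize_of_forall_obj (M := M) (n := n)
    ((appFormula (R ∩ S)).iff (appFormula R ⊓ appFormula S)) (fun v => by
      simp only [BoundedFormula.realize_iff, BoundedFormula.realize_inf, realize_appFormula]
      rfl) x
  simpa only [BoundedFormula.realize_iff, BoundedFormula.realize_inf, realize_appFormula] using h

theorem relMap_compl (R : Set (Fin n → Obj)) (x : Fin n → M) :
    Structure.RelMap (L := fullLanguage) (n := n) (Rᶜ : Set _) x ↔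
      ¬ Structure.RelMap (L := fullLanguage) (n := n) R x := by
  have h := realize_of_forall_obj (M := M) (n := n)
    ((appFormula Rᶜ).iff (appFormula R).not) (fun v => by
      simp only [BoundedFormula.realize_iff, BoundedFormula.realize_not, realize_appFormula]
      rfl) x
  simpa only [BoundedFormula.realize_iff, BoundedFormula.realize_not, realize_appFormula] using h

theorem relMap_univ (x : Fin n → M) :
    Structure.RelMap (L := fullLanguage) (n := n) (Set.univ : Set (Fin n → Obj)) x := by
  have h := realize_of_forall_obj (M := M) (n := n) (appFormula Set.univ) (fun v => by
      simp only [realize_appFormula]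
      trivial) x
  simpa only [realize_appFormula] using h

theorem funMap_eq_iff (f g : (Fin n → Obj) → Obj) (x : Fin n → M) :
    Structure.funMap (L := fullLanguage) (n := n) f x =
        Structure.funMap (L := fullLanguage) (n := n) g x ↔
      Structure.RelMap (L := fullLanguage) (n := n) {o | f o = g o} x := by
  have h := realize_of_forall_obj (M := M) (n := n)
    (((appTerm f).bdEqual (appTerm g)).iff (appFormula {o | f o = g o})) (fun v => by
      rw [BoundedFormula.realize_iff, realize_appFormula, BoundedFormula.realize_bdEqual]
      rfl) x
  rw [BoundedFormula.realize_iff, realize_appFormula, BoundedFormula.realize_bdEqual] at h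
  exact h

theorem funMap_comp (g : (Fin k → Obj) → Obj) (f : Fin k → (Fin n → Obj) → Obj) (x : Fin n → M) :
    Structure.funMap (L := fullLanguage) (n := k) g
        (fun i => Structure.funMap (L := fullLanguage) (n := n) (f i) x) =
      Structure.funMap (L := fullLanguage) (n := n) (fun o => g fun i => f i o) x := by
  have h := realize_of_forall_obj (M := M) (n := n)
    ((Term.func (l := k) (show fullLanguage.Functions k from g) fun i => appTerm (f i)).bdEqual
      (appTerm fun o => g fun i => f i o)) (fun v => by
      rw [BoundedFormula.realize_bdEqual]
      rfl) x
  rw [BoundedFormula.realize_bdEqual] at h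
  exact h

theorem funMap_proj (i : Fin n) (x : Fin n → M) :
    Structure.funMap (L := fullLanguage) (n := n) (fun o : Fin n → Obj => o i) x = x i := by
  have h := realize_of_forall_obj (M := M) (n := n)
    ((appTerm fun o => o i).bdEqual (Term.var (Sum.inr i))) (fun v => by
      rw [BoundedFormula.realize_bdEqual]
      rfl) x
  rw [BoundedFormula.realize_bdEqual] at h
  exact h

/-- The ultrafilter of those standard relations whose nonstandard extensions hold at the
tuple `x`. -/
def ultrafilterAt (x : Fin n → M) : Ultrafilter (Fin n → Obj) :=
  Ultrafilter.ofComplNotMemIff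
    { sets := {R | Structure.RelMap (L := fullLanguage) (n := n) R x}
      univ_sets := relMap_univ x
      sets_of_superset := fun {R S} hR hRS => by
        have h : R ∩ S = R := Set.inter_eq_left.2 hRS
        exact ((relMap_inter R S x).1 (h.symm ▸ hR)).2
      inter_sets := fun {R S} hR hS => (relMap_inter R S x).2 ⟨hR, hS⟩ }
    (fun R => ((relMap_compl R x).not.trans not_not))

theorem eventually_ultrafilterAt (x : Fin n → M) (P : (Fin n → Obj) → Prop) :
    (∀ᶠ o in ultrafilterAt x, P o) ↔
      Structure.RelMap (L := fullLanguage) (n := n) {o | P o} x := Iff.rfl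

variable {α β γ : Type} [StdSort α] [StdSort β] [StdSort γ]

/-- The element of `*α` represented by the function `F`, in the manner of an ultrapower. -/
def Star.ofFun (x : Fin n → M) (F : (Fin n → Obj) → α) : Star M α :=
  ⟨Structure.funMap (L := fullLanguage) (n := n) (fun o => StdSort.code (F o)) x, by
    have h := (relMap_comp (M := M) (k := 1) (sortSymb α) ![fun o => StdSort.code (F o)] x).2
      ((eventually_ultrafilterAt x _).1 (Eventually.of_forall fun o => ⟨F o, rfl⟩))
    convert h using 1
    funext i
    fin_cases i
    rfl⟩

theorem Star.ofFun_eq_iff (x : Fin n → M) (F G : (Fin n → Obj) → α) :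
    Star.ofFun x F = Star.ofFun x G ↔ ∀ᶠ o in ultrafilterAt x, F o = G o := by
  rw [Star.ext_iff]
  refine (funMap_eq_iff _ _ x).trans ((eventually_ultrafilterAt x _).symm.trans ?_)
  simp only [StdSort.code_injective.eq_iff]

/-- Łoś's theorem for atomic formulas. -/
theorem Star.rel_ofFun (R : α → β → Prop) (x : Fin n → M) (F : (Fin n → Obj) → α)
    (G : (Fin n → Obj) → β) :
    Star.rel R (Star.ofFun x F) (Star.ofFun x G) ↔ ∀ᶠ o in ultrafilterAt x, R (F o) (G o) := by
  have h := relMap_comp (M := M) (k := 2) (relSymb R)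
    ![fun o => StdSort.code (F o), fun o => StdSort.code (G o)] x
  have e : (fun i => Structure.funMap (L := fullLanguage) (n := n)
      ((![fun o => StdSort.code (F o), fun o => StdSort.code (G o)] :
        Fin 2 → (Fin n → Obj) → Obj) i) x) =
      ![(Star.ofFun x F).val, (Star.ofFun x G).val] := by
    funext i
    fin_cases i <;> rfl
  rw [e] at h
  refine h.trans ((eventually_ultrafilterAt x _).symm.trans (eventually_congr
    (Eventually.of_forall fun o => ⟨?_, fun hR => ⟨F o, G o, rfl, rfl, hR⟩⟩)))
  rintro ⟨a, b, ha, hb, hR⟩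
  have ha' : F o = a := StdSort.code_injective ha
  have hb' : G o = b := StdSort.code_injective hb
  rwa [ha', hb']

theorem Star.std_eq_ofFun (x : Fin n → M) (a : α) : Star.std M a = Star.ofFun x fun _ => a := by
  rw [Star.ext_iff]
  have h := funMap_comp (M := M) (k := 0) (constSymb a) ![] x
  rw [Subsingleton.elim (fun i => Structure.funMap (L := fullLanguage) (n := n)
    ((![] : Fin 0 → (Fin n → Obj) → Obj) i) x) ![] ] at h
  exact h

theorem funSymb₁_code (f : α → β) (v : Fin 1 → Obj) (a : α) (hv : v 0 = StdSort.code a) :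
    (show (Fin 1 → Obj) → Obj from funSymb₁ f) v = StdSort.code (f a) := by
  have h : ∃ a : α, v 0 = StdSort.code a := ⟨a, hv⟩
  have e : h.choose = a := StdSort.code_injective (h.choose_spec.symm.trans hv)
  refine (dif_pos h).trans ?_
  rw [e]

theorem funSymb₂_code (f : α → β → γ) (v : Fin 2 → Obj) (a : α) (b : β)
    (ha : v 0 = StdSort.code a) (hb : v 1 = StdSort.code b) :
    (show (Fin 2 → Obj) → Obj from funSymb₂ f) v = StdSort.code (f a b) := by
  have h : ∃ p : α × β, v 0 = StdSort.code p.1 ∧ v 1 = StdSort.code p.2 := ⟨(a, b), ha, hb⟩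
  have ea : h.choose.1 = a := StdSort.code_injective (h.choose_spec.1.symm.trans ha)
  have eb : h.choose.2 = b := StdSort.code_injective (h.choose_spec.2.symm.trans hb)
  refine (dif_pos h).trans ?_
  rw [ea, eb]

theorem Star.map_ofFun (f : α → β) (x : Fin n → M) (F : (Fin n → Obj) → α) :
    Star.map f (Star.ofFun x F) = Star.ofFun x fun o => f (F o) := by
  rw [Star.ext_iff]
  have h := funMap_comp (M := M) (k := 1) (funSymb₁ f) ![fun o => StdSort.code (F o)] x
  have e : (fun i => Structure.funMap (L := fullLanguage) (n := n)
      ((![fun o => StdSort.code (F o)] : Fin 1 → (Fin n → Obj) → Obj) i) x) =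
      ![(Star.ofFun x F).val] := by
    funext i
    fin_cases i
    rfl
  rw [e] at h
  refine h.trans ?_
  change _ = Structure.funMap (L := fullLanguage) (n := n) _ x
  congr 1
  funext o
  exact funSymb₁_code f _ (F o) rfl

theorem Star.map₂_ofFun (f : α → β → γ) (x : Fin n → M) (F : (Fin n → Obj) → α)
    (G : (Fin n → Obj) → β) :
    Star.map₂ f (Star.ofFun x F) (Star.ofFun x G) = Star.ofFun x fun o => f (F o) (G o) := by
  rw [Star.ext_iff]
  have h := funMap_comp (M := M) (k := 2) (funSymb₂ f)
    ![fun o => StdSort.code (F o), fun o => StdSort.code (G o)] x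
  have e : (fun i => Structure.funMap (L := fullLanguage) (n := n)
      ((![fun o => StdSort.code (F o), fun o => StdSort.code (G o)] :
        Fin 2 → (Fin n → Obj) → Obj) i) x) =
      ![(Star.ofFun x F).val, (Star.ofFun x G).val] := by
    funext i
    fin_cases i <;> rfl
  rw [e] at h
  refine h.trans ?_
  change _ = Structure.funMap (L := fullLanguage) (n := n) _ x
  congr 1
  funext o
  exact funSymb₂_code f _ (F o) (G o) rfl rfl

/-- The representing function decodes the `i`-th coordinate. It is junk on coordinates of another
sort, but these are negligible because `x i` has sort `α`. Any finite list of elements, gathered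
into one tuple, can thus be represented over one ultrafilter. -/
theorem Star.exists_eq_ofFun [Nonempty α] (x : Fin n → M) (i : Fin n) (s : Star M α)
    (hs : x i = s.val) : ∃ F : (Fin n → Obj) → α, s = Star.ofFun x F := by
  refine ⟨fun o => Function.invFun StdSort.code (o i), ?_⟩
  rw [Star.ext_iff, ← hs, ← funMap_proj i x]
  refine (funMap_eq_iff _ _ x).2 ((eventually_ultrafilterAt x _).1 ?_)
  have h := relMap_comp (M := M) (k := 1) (sortSymb α) ![fun o => o i] x
  have e : (fun j => Structure.funMap (L := fullLanguage) (n := n)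
      ((![fun o => o i] : Fin 1 → (Fin n → Obj) → Obj) j) x) = ![s.val] := by
    funext j
    fin_cases j
    exact (funMap_proj i x).trans hs
  rw [e] at h
  filter_upwards [(eventually_ultrafilterAt x _).2 (h.1 s.property)] with o ho
  exact (Function.invFun_eq (f := StdSort.code) (by
    obtain ⟨a, ha⟩ := ho
    exact ⟨a, ha.symm⟩)).symm

end Transfer

/-! ### Internal sets and the Loeb measure -/

section Internal

variable {M : Type u} [fullLanguage.Structure M] [NonstandardExtension M] {n d : ℕ}

theorem Star.ofFun_mem_extent (x : Fin n → M) (F : (Fin n → Obj) → Fin d → ℤ)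
    (A : (Fin n → Obj) → Set (Fin d → ℤ)) :
    Star.ofFun x F ∈ (Star.ofFun x A).extent ↔ ∀ᶠ o in ultrafilterAt x, F o ∈ A o :=
  Star.rel_ofFun _ x F A

/-- If the inclusion failed eventually, pointwise counterexamples would represent an element of the
first extent outside the second. -/
theorem Star.extent_ofFun_subset (x : Fin n → M) (A B : (Fin n → Obj) → Set (Fin d → ℤ))
    (h : (Star.ofFun x A).extent ⊆ (Star.ofFun x B).extent) :
    ∀ᶠ o in ultrafilterAt x, A o ⊆ B o := by
  classical
  by_contra hn
  rw [← Ultrafilter.eventually_not] at hn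
  let F : (Fin n → Obj) → Fin d → ℤ := fun o =>
    if ho : ∃ y, y ∈ A o ∧ y ∉ B o then ho.choose else 0
  have hF : ∀ᶠ o in ultrafilterAt x, F o ∈ A o ∧ F o ∉ B o := by
    filter_upwards [hn] with o ho
    have ho' : ∃ y, y ∈ A o ∧ y ∉ B o := Set.not_subset.1 ho
    have e : F o = ho'.choose := dif_pos ho'
    rw [e]
    exact ho'.choose_spec
  have hB := (Star.ofFun_mem_extent x F B).1
    (h ((Star.ofFun_mem_extent x F A).2 (hF.mono fun _ => And.left)))
  obtain ⟨o, h1, h2⟩ := (hF.and hB).exists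
  exact h1.2 h2

/-- This makes `hcard` independent of the chosen representative of an internal set. -/
theorem Star.extent_injective :
    Function.Injective (Star.extent : Star M (Set (Fin d → ℤ)) → _) := by
  intro A B h
  let x : Fin 2 → M := ![A.val, B.val]
  obtain ⟨F, hF⟩ := Star.exists_eq_ofFun x 0 A rfl
  obtain ⟨G, hG⟩ := Star.exists_eq_ofFun x 1 B rfl
  rw [hF, hG] at h ⊢
  rw [Star.ofFun_eq_iff]
  filter_upwards [Star.extent_ofFun_subset x F G h.subset,
    Star.extent_ofFun_subset x G F h.symm.subset] with o h1 h2
  exact h1.antisymm h2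

theorem hcard_extent (A : Star M (Set (Fin d → ℤ))) :
    hcard A.extent = Star.map (fun S : Set (Fin d → ℤ) => (S.ncard : ℝ)) A := by
  have h : IsInternal A.extent := ⟨A, rfl⟩
  have e : h.choose = A := Star.extent_injective h.choose_spec.symm
  rw [hcard, dif_pos h, e]

theorem Star.extent_map₂_inter (A B : Star M (Set (Fin d → ℤ))) :
    (Star.map₂ (· ∩ ·) A B).extent = A.extent ∩ B.extent := by
  ext y
  let x : Fin 3 → M := ![A.val, B.val, y.val]
  obtain ⟨F, hF⟩ := Star.exists_eq_ofFun x 0 A rfl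
  obtain ⟨G, hG⟩ := Star.exists_eq_ofFun x 1 B rfl
  obtain ⟨K, hK⟩ := Star.exists_eq_ofFun x 2 y rfl
  rw [hF, hG, hK]
  simp only [Set.mem_inter_iff, Star.map₂_ofFun, Star.ofFun_mem_extent, eventually_and]

theorem Star.extent_map₂_sdiff (A B : Star M (Set (Fin d → ℤ))) :
    (Star.map₂ (· \ ·) A B).extent = A.extent \ B.extent := by
  ext y
  let x : Fin 3 → M := ![A.val, B.val, y.val]
  obtain ⟨F, hF⟩ := Star.exists_eq_ofFun x 0 A rfl
  obtain ⟨G, hG⟩ := Star.exists_eq_ofFun x 1 B rfl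
  obtain ⟨K, hK⟩ := Star.exists_eq_ofFun x 2 y rfl
  rw [hF, hG, hK]
  simp only [Set.mem_sdiff, Star.map₂_ofFun, Star.ofFun_mem_extent, eventually_and,
    Ultrafilter.eventually_not]

theorem stdPart_ofFun (x : Fin n → M) (F : (Fin n → Obj) → ℝ) :
    stdPart (Star.ofFun x F) = sSup {r : ℝ | ∀ᶠ o in ultrafilterAt x, r ≤ F o} := by
  rw [stdPart]
  congr 1
  ext r
  rw [Set.mem_ofPred_eq, Star.std_eq_ofFun x r]
  exact Star.rel_ofFun _ x _ F

theorem stdPart_ofFun_nonneg (x : Fin n → M) (F : (Fin n → Obj) → ℝ)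
    (h0 : ∀ᶠ o in ultrafilterAt x, 0 ≤ F o) : 0 ≤ stdPart (Star.ofFun x F) := by
  rw [stdPart_ofFun]
  by_cases hb : BddAbove {r : ℝ | ∀ᶠ o in ultrafilterAt x, r ≤ F o}
  · exact le_csSup hb h0
  -- The supremum of an unbounded set is 0 by convention.
  · rw [Real.sSup_of_not_bddAbove hb]

/-- The standard bound `c` keeps the supremum defining the right-hand side from falling to its
default value. -/
theorem stdPart_add_le (x : Fin n → M) (F G K : (Fin n → Obj) → ℝ) (c : ℝ)
    (hF : ∀ᶠ o in ultrafilterAt x, 0 ≤ F o) (hG : ∀ᶠ o in ultrafilterAt x, 0 ≤ G o)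
    (hK : ∀ᶠ o in ultrafilterAt x, F o + G o ≤ K o) (hc : ∀ᶠ o in ultrafilterAt x, K o ≤ c) :
    stdPart (Star.ofFun x F) + stdPart (Star.ofFun x G) ≤ stdPart (Star.ofFun x K) := by
  simp only [stdPart_ofFun]
  have hb : BddAbove {r : ℝ | ∀ᶠ o in ultrafilterAt x, r ≤ K o} := by
    refine ⟨c, fun r hr => ?_⟩
    obtain ⟨o, h1, h2⟩ := (hc.and hr).exists
    exact h2.trans h1
  rw [← le_sub_iff_add_le]
  refine csSup_le ⟨0, hF⟩ fun r hr => ?_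
  rw [le_sub_comm]
  refine csSup_le ⟨0, hG⟩ fun s hs => ?_
  rw [le_sub_iff_add_le']
  refine le_csSup hb ?_
  filter_upwards [hr, hs, hK] with o h1 h2 h3
  linarith

/-- A set is hyperfinite if it is internal and its internal cardinality is bounded by a
hypernatural number. -/
def IsHyperfinite (B : Set (Star M (Fin d → ℤ))) : Prop :=
  ∃ (A : Star M (Set (Fin d → ℤ))) (N : Star M ℕ), B = A.extent ∧
    Star.rel (fun (S : Set (Fin d → ℤ)) (k : ℕ) => S.Finite ∧ S.ncard ≤ k) A N

/-- Measurability for an outer measure of the form `boundedBy` needs only superadditivity of the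
generating set function under cutting by `S`. On internal sets this comes from additivity of
counting. -/
theorem loebOuter_caratheodory {B S : Set (Star M (Fin d → ℤ))} (hB : IsHyperfinite B)
    (hS : IsInternal S) :
    @MeasurableSet B (loebOuter B).caratheodory (Subtype.val ⁻¹' S : Set B) := by
  obtain ⟨B, N, rfl, hN⟩ := hB
  obtain ⟨S, rfl⟩ := hS
  refine MeasureTheory.OuterMeasure.boundedBy_caratheodory fun T => ?_
  -- For a test set that is not internal the infimum is over an empty family, hence `∞`; only
  -- internal test sets remain.
  refine le_iInf fun ⟨T', hT'⟩ => ?_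
  have e1 : Subtype.val '' (T ∩ Subtype.val ⁻¹' S.extent) = (Star.map₂ (· ∩ ·) T' S).extent := by
    rw [Set.image_inter_preimage, hT', Star.extent_map₂_inter]
  have e2 : Subtype.val '' (T \ Subtype.val ⁻¹' S.extent) = (Star.map₂ (· \ ·) T' S).extent := by
    rw [Set.image_sdiff_preimage, hT', Star.extent_map₂_sdiff]
  have hsub : T'.extent ⊆ B.extent := hT' ▸ Subtype.coe_image_subset _ T
  refine (add_le_add (iInf_le _ ⟨_, e1⟩) (iInf_le _ ⟨_, e2⟩)).trans ?_
  rw [e1, e2, hT']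
  simp only [hcard_extent]
  let x : Fin 4 → M := ![B.val, N.val, S.val, T'.val]
  obtain ⟨FB, hFB⟩ := Star.exists_eq_ofFun x 0 B rfl
  obtain ⟨FN, hFN⟩ := Star.exists_eq_ofFun x 1 N rfl
  obtain ⟨FS, hFS⟩ := Star.exists_eq_ofFun x 2 S rfl
  obtain ⟨FT, hFT⟩ := Star.exists_eq_ofFun x 3 T' rfl
  rw [hFB, hFN, Star.rel_ofFun] at hN
  rw [hFB, hFT] at hsub
  replace hsub := Star.extent_ofFun_subset x _ _ hsub
  rw [hFB, hFS, hFT]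
  change ENNReal.ofReal (stdPart (Star.map₂ (· / ·) _ _)) +
    ENNReal.ofReal (stdPart (Star.map₂ (· / ·) _ _)) ≤
    ENNReal.ofReal (stdPart (Star.map₂ (· / ·) _ _))
  simp only [Star.map₂_ofFun, Star.map_ofFun]
  rw [← ENNReal.ofReal_add (stdPart_ofFun_nonneg _ _ (Eventually.of_forall fun o => by positivity))
    (stdPart_ofFun_nonneg _ _ (Eventually.of_forall fun o => by positivity))]
  refine ENNReal.ofReal_le_ofReal (stdPart_add_le x _ _ _ 1
    (Eventually.of_forall fun o => by positivity)
    (Eventually.of_forall fun o => by positivity) ?_ ?_)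
  -- Hyperfiniteness of `B` excludes the value 0 that `ncard` gives to infinite sets.
  · filter_upwards [hN, hsub] with o h1 h2
    rw [← add_div]
    gcongr
    exact_mod_cast (Set.ncard_inter_add_ncard_sdiff_eq_ncard (FT o) (FS o) (h1.1.subset h2)).le
  · filter_upwards [hN, hsub] with o h1 h2
    exact div_le_one_of_le₀ (by exact_mod_cast Set.ncard_le_ncard h2 h1.1) (by positivity)

/-- On a measurable set the measure is the outer measure, and `S ∩ B` covers itself. -/
theorem loeb_le_of_isInternal {B S : Set (Star M (Fin d → ℤ))} (hB : IsHyperfinite B)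
    (hS : IsInternal S) (hSB : IsInternal (S ∩ B)) :
    loeb B S ≤ ENNReal.ofReal (stdPart (hcard (S ∩ B) / hcard B)) := by
  let _ : MeasurableSpace B := (loebOuter B).caratheodory
  rw [loeb, loebMeasure, MeasureTheory.toMeasure_apply _ _ (loebOuter_caratheodory hB hS)]
  refine (MeasureTheory.OuterMeasure.boundedBy_le _).trans ?_
  have e : Subtype.val '' (Subtype.val ⁻¹' S : Set B) = S ∩ B := by
    rw [Subtype.image_preimage_coe, Set.inter_comm]
  refine (iInf_le _ (e ▸ hSB)).trans_eq ?_
  rw [e]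

/-- Continuity from below along an increasing sequence, which holds without measurability of its
members. -/
theorem exists_lt_loeb_of_subset_iUnion {B S : Set (Star M (Fin d → ℤ))}
    {E : ℕ → Set (Star M (Fin d → ℤ))} (hE : Monotone E) (hS : S ⊆ ⋃ m, E m) {c : ℝ≥0∞}
    (hc : c < loeb B S) : ∃ m, c < loeb B (E m) := by
  let _ := (loebOuter B).caratheodory
  have h : c < loebMeasure B (⋃ m, Subtype.val ⁻¹' E m) := by
    refine hc.trans_le (MeasureTheory.measure_mono ?_)
    rw [← Set.preimage_iUnion]
    exact Set.preimage_mono hS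
  have hmono : Monotone fun m => (Subtype.val ⁻¹' E m : Set B) :=
    fun i j hij => Set.preimage_mono (hE hij)
  rw [hmono.measure_iUnion] at h
  exact lt_iSup_iff.1 h

theorem exists_std_le_of_lt_stdPart {c : ℝ} (hc : 0 ≤ c) (y : Star M ℝ) (h : c < stdPart y) :
    ∃ r, c < r ∧ Star.std M r ≤ y := by
  have hne : {r : ℝ | Star.std M r ≤ y}.Nonempty := by
    -- The supremum of the empty set is 0 by convention, which `0 ≤ c` rules out.
    by_contra hne
    rw [stdPart, Set.not_nonempty_iff_eq_empty.1 hne, Real.sSup_empty] at h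
    exact hc.not_gt h
  obtain ⟨r, hr, hcr⟩ := exists_lt_of_lt_csSup hne h
  exact ⟨r, hcr, hr⟩

end Internal

/-! ### Counting in standard boxes -/

section Boxes

variable {d : ℕ}

variable (d) in
/-- The box `[-n, n]^d` in `ℤ^d`. -/
def box (n : ℕ) : Set (Fin d → ℤ) := {y | ∀ i, -(n : ℤ) ≤ y i ∧ y i ≤ n}

theorem box_eq_Icc (n : ℕ) :
    box d n = ((Finset.Icc (fun _ => -(n : ℤ)) fun _ => (n : ℤ) : Finset (Fin d → ℤ)) : Set _) := by
  ext y
  simp only [box, Set.mem_ofPred_eq, Finset.coe_Icc, Set.mem_Icc, Pi.le_def, forall_and]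

theorem finite_box (n : ℕ) : (box d n).Finite := by
  rw [box_eq_Icc]
  exact Finset.finite_toSet _

theorem ncard_box (n : ℕ) : (box d n).ncard = (2 * n + 1) ^ d := by
  rw [box_eq_Icc, Set.ncard_coe_finset, Pi.card_Icc]
  simp only [Int.card_Icc, Finset.prod_const, Finset.card_univ, Fintype.card_fin]
  congr 1
  omega

theorem ncard_singleton_add (a : Fin d → ℤ) (S : Set (Fin d → ℤ)) :
    ({a} + S).ncard = S.ncard := by
  rw [Set.singleton_add]
  exact Set.ncard_image_of_injective _ (add_right_injective a)

theorem box_mono : Monotone (box d) := fun m n h y hy i => by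
  have h' : (m : ℤ) ≤ n := by exact_mod_cast h
  exact ⟨by linarith [(hy i).1], by linarith [(hy i).2]⟩

theorem add_mem_box {m n : ℕ} {x y : Fin d → ℤ} (hx : x ∈ box d m) (hy : y ∈ box d n) :
    x + y ∈ box d (m + n) := fun i => by
  have h1 := hx i
  have h2 := hy i
  rw [Pi.add_apply]
  push_cast
  exact ⟨by linarith, by linarith⟩

theorem neg_mem_box {n : ℕ} {x : Fin d → ℤ} (hx : x ∈ box d n) : -x ∈ box d n := fun i => by
  have h := hx i
  rw [Pi.neg_apply]
  exact ⟨by linarith, by linarith⟩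

theorem exists_mem_box (z : Fin d → ℤ) : ∃ k, z ∈ box d k := by
  refine ⟨∑ i, (z i).natAbs, fun i => ?_⟩
  have h : (z i).natAbs ≤ ∑ j, (z j).natAbs :=
    Finset.single_le_sum (f := fun j => (z j).natAbs) (fun _ _ => Nat.zero_le _)
      (Finset.mem_univ i)
  omega

/-- The ratio of the volumes is `(1 + 2k / (2n + 1)) ^ d`, which tends to 1: boxes form a Følner
sequence. -/
theorem eventually_ncard_box_add_lt (k : ℕ) {c : ℝ} (hc : 1 < c) :
    ∀ᶠ n : ℕ in atTop, ((box d (n + k)).ncard : ℝ) < c * (box d n).ncard := by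
  have h1 : Tendsto (fun n : ℕ => (2 * (k : ℝ)) / (2 * (n : ℝ) + 1)) atTop (nhds 0) :=
    tendsto_const_nhds.div_atTop (tendsto_atTop_add_const_right _ _
      (tendsto_natCast_atTop_atTop.const_mul_atTop two_pos))
  have h2 : Tendsto (fun n : ℕ => (1 + (2 * (k : ℝ)) / (2 * (n : ℝ) + 1)) ^ d) atTop (nhds 1) := by
    simpa using (h1.const_add 1).pow d
  filter_upwards [h2.eventually_lt_const hc] with n hn
  rw [ncard_box, ncard_box]
  push_cast
  have hpos : (0 : ℝ) < 2 * n + 1 := by positivity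
  have e : (2 * ((n : ℝ) + k) + 1) ^ d =
      (1 + (2 * (k : ℝ)) / (2 * (n : ℝ) + 1)) ^ d * (2 * n + 1) ^ d := by
    rw [← mul_pow]
    congr 1
    field_simp
    ring
  rw [e]
  gcongr

/-- Two sets of density more than a half in the boxes of radius `n` about `a` and `b` have a sumset
containing `a + b + z`, provided that `n` is large compared with `z`. -/
theorem eventually_mem_add_of_dense {r : ℝ} (hr : 1 / 2 < r) (z : Fin d → ℤ) :
    ∀ᶠ n : ℕ in atTop, ∀ (P Q : Set (Fin d → ℤ)) (a b : Fin d → ℤ),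
      r ≤ ((P ∩ ({a} + box d n)).ncard : ℝ) / ({a} + box d n).ncard →
      r ≤ ((Q ∩ ({b} + box d n)).ncard : ℝ) / ({b} + box d n).ncard → a + b + z ∈ P + Q := by
  obtain ⟨k, hk⟩ := exists_mem_box z
  -- The two dense sets have at least `2 * r` times the volume of the box between them, so the
  -- enlarged box must stay below that factor.
  filter_upwards [eventually_ncard_box_add_lt (d := d) k (c := 2 * r) (by linarith)] with
    n hn P Q a b hP hQ
  have hpos : (0 : ℝ) < (box d n).ncard := by
    rw [ncard_box]
    positivity
  rw [ncard_singleton_add, le_div_iff₀ hpos] at hP hQ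
  by_contra hmem
  -- A common point of `P'` and the reflected set `Q'` would write `a + b + z` as a sum from `P +
  -- Q`. Disjoint, they are too large for the box of radius `n + k` about `a`.
  set P' := P ∩ ({a} + box d n)
  set Q' := (fun y => a + b + z - y) '' (Q ∩ ({b} + box d n))
  have hcard : Q'.ncard = (Q ∩ ({b} + box d n)).ncard :=
    Set.ncard_image_of_injective _ (sub_right_injective)
  have hdisj : Disjoint P' Q' := by
    rw [Set.disjoint_left]
    rintro p hp ⟨q, hq, rfl⟩
    exact hmem ⟨_, hp.1, q, hq.1, sub_add_cancel _ _⟩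
  have hfin : ({a} + box d (n + k)).Finite := (Set.finite_singleton a).add (finite_box _)
  have hsub : P' ∪ Q' ⊆ {a} + box d (n + k) := by
    rw [Set.singleton_add (a := a) (t := box d (n + k))]
    rintro p (⟨-, _, rfl, y, hy, rfl⟩ | ⟨q, ⟨-, _, rfl, y, hy, rfl⟩, rfl⟩)
    · exact ⟨y, box_mono (Nat.le_add_right n k) hy, rfl⟩
    -- Here `a + b + z - (b + y) = a + (-y + z)`.
    · refine ⟨-y + z, add_mem_box (neg_mem_box hy) hk, ?_⟩
      dsimp only
      abel
  have h1 := Set.ncard_le_ncard hsub hfin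
  rw [Set.ncard_union_eq hdisj (hfin.subset (Set.subset_union_left.trans hsub))
    (hfin.subset (Set.subset_union_right.trans hsub)), hcard, ncard_singleton_add] at h1
  have h2 : ((P'.ncard : ℝ) + (Q ∩ ({b} + box d n)).ncard) ≤ (box d (n + k)).ncard := by
    exact_mod_cast h1
  linarith

end Boxes

/-! ### From points of density to syndeticity -/

section Density

variable {M : Type u} [fullLanguage.Structure M] [NonstandardExtension M] {n d : ℕ}

theorem Star.add_ofFun (x : Fin n → M) (F G : (Fin n → Obj) → Fin d → ℤ) :
    Star.ofFun x F + Star.ofFun x G = Star.ofFun x fun o => F o + G o :=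
  Star.map₂_ofFun _ x F G

theorem Star.lt_ofFun (x : Fin n → M) (F G : (Fin n → Obj) → ℕ) :
    Star.ofFun x F < Star.ofFun x G ↔ ∀ᶠ o in ultrafilterAt x, F o < G o :=
  Star.rel_ofFun _ x F G

theorem ofFun_mem_cube (x : Fin n → M) (F : (Fin n → Obj) → Fin d → ℤ) (N : (Fin n → Obj) → ℕ) :
    Star.ofFun x F ∈ cube d (Star.ofFun x N) ↔ ∀ᶠ o in ultrafilterAt x, F o ∈ box d (N o) :=
  Star.rel_ofFun _ x F N

/-- The internal box `a + [-ν, ν]^d` as an element of `*P(ℤ^d)`. -/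
noncomputable def starBox (a : Star M (Fin d → ℤ)) (ν : Star M ℕ) : Star M (Set (Fin d → ℤ)) :=
  Star.map₂ (fun y k => {y} + box d k) a ν

theorem extent_starBox (a : Star M (Fin d → ℤ)) (ν : Star M ℕ) :
    (starBox a ν).extent = {a} + cube d ν := by
  ext y
  rw [Set.singleton_add, starBox]
  constructor
  · intro h
    let x : Fin 3 → M := ![a.val, ν.val, y.val]
    obtain ⟨F, hF⟩ := Star.exists_eq_ofFun x 0 a rfl
    obtain ⟨N, hN⟩ := Star.exists_eq_ofFun x 1 ν rfl
    obtain ⟨K, hK⟩ := Star.exists_eq_ofFun x 2 y rfl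
    rw [hF, hN, hK, Star.map₂_ofFun, Star.ofFun_mem_extent] at h
    rw [hF, hN, hK]
    refine ⟨Star.ofFun x fun o => K o - F o, (ofFun_mem_cube x _ _).2 ?_, ?_⟩
    · filter_upwards [h] with o ho
      rw [Set.singleton_add] at ho
      obtain ⟨c, hc, hcK⟩ := ho
      rw [← hcK]
      simpa using hc
    · dsimp only
      rw [Star.add_ofFun]
      congr 1
      funext o
      abel
  · rintro ⟨c, hc, rfl⟩
    let x : Fin 3 → M := ![a.val, ν.val, c.val]
    obtain ⟨F, hF⟩ := Star.exists_eq_ofFun x 0 a rfl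
    obtain ⟨N, hN⟩ := Star.exists_eq_ofFun x 1 ν rfl
    obtain ⟨K, hK⟩ := Star.exists_eq_ofFun x 2 c rfl
    rw [hN, hK, ofFun_mem_cube] at hc
    dsimp only
    rw [hF, hN, hK, Star.map₂_ofFun, Star.add_ofFun, Star.ofFun_mem_extent]
    filter_upwards [hc] with o ho
    exact Set.add_mem_add rfl ho

theorem isHyperfinite_extent_starBox (a : Star M (Fin d → ℤ)) (ν : Star M ℕ) :
    IsHyperfinite (starBox a ν).extent := by
  refine ⟨_, Star.map (fun k => (2 * k + 1) ^ d) ν, rfl, ?_⟩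
  let x : Fin 2 → M := ![a.val, ν.val]
  obtain ⟨F, hF⟩ := Star.exists_eq_ofFun x 0 a rfl
  obtain ⟨N, hN⟩ := Star.exists_eq_ofFun x 1 ν rfl
  rw [starBox, hF, hN, Star.map₂_ofFun, Star.map_ofFun, Star.rel_ofFun]
  refine Eventually.of_forall fun o => ⟨(Set.finite_singleton _).add (finite_box _), ?_⟩
  rw [ncard_singleton_add, ncard_box]

/-- The internal set `A + [-m, m]^d` as an element of `*P(ℤ^d)`. -/
noncomputable def starThicken (A : Star M (Set (Fin d → ℤ))) (m : ℕ) :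
    Star M (Set (Fin d → ℤ)) :=
  Star.map (· + box d m) A

theorem monotone_extent_starThicken (A : Star M (Set (Fin d → ℤ))) :
    Monotone fun m => (starThicken A m).extent := by
  intro m k hmk y hy
  let x : Fin 2 → M := ![A.val, y.val]
  obtain ⟨F, hF⟩ := Star.exists_eq_ofFun x 0 A rfl
  obtain ⟨K, hK⟩ := Star.exists_eq_ofFun x 1 y rfl
  simp only [starThicken] at hy ⊢
  rw [hF, hK, Star.map_ofFun, Star.ofFun_mem_extent] at hy ⊢
  exact hy.mono fun o ho => Set.add_subset_add_left (box_mono hmk) ho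

/-- Each standard lattice point lies in a standard box. This replaces the external set `A + ℤ^d` by
countably many internal ones. -/
theorem extent_add_stdLattice_subset (A : Star M (Set (Fin d → ℤ))) :
    A.extent + stdLattice M d ⊆ ⋃ m, (starThicken A m).extent := by
  rintro _ ⟨e, he, _, ⟨z, rfl⟩, rfl⟩
  obtain ⟨k, hk⟩ := exists_mem_box z
  refine Set.mem_iUnion.2 ⟨k, ?_⟩
  let x : Fin 2 → M := ![A.val, e.val]
  obtain ⟨F, hF⟩ := Star.exists_eq_ofFun x 0 A rfl
  obtain ⟨K, hK⟩ := Star.exists_eq_ofFun x 1 e rfl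
  rw [hF, hK, Star.ofFun_mem_extent] at he
  dsimp only
  rw [starThicken, hF, hK, Star.std_eq_ofFun x z, Star.map_ofFun, Star.add_ofFun,
    Star.ofFun_mem_extent]
  exact he.mono fun o ho => Set.add_mem_add ho hk

/-- The internal density of `A + [-m, m]^d` in the box of radius `ν` about `a`. -/
noncomputable def starRatio (A : Star M (Set (Fin d → ℤ))) (m : ℕ) (a : Star M (Fin d → ℤ))
    (ν : Star M ℕ) : Star M ℝ :=
  hcard ((starThicken A m).extent ∩ (starBox a ν).extent) / hcard (starBox a ν).extent

theorem starRatio_ofFun (x : Fin n → M) (F : (Fin n → Obj) → Set (Fin d → ℤ)) (m : ℕ)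
    (G : (Fin n → Obj) → Fin d → ℤ) (N : (Fin n → Obj) → ℕ) :
    starRatio (Star.ofFun x F) m (Star.ofFun x G) (Star.ofFun x N) =
      Star.ofFun x fun o => (((F o + box d m) ∩ ({G o} + box d (N o))).ncard : ℝ) /
        ({G o} + box d (N o)).ncard := by
  rw [starRatio, ← Star.extent_map₂_inter, hcard_extent, hcard_extent, starThicken, starBox]
  simp only [Star.map₂_ofFun, Star.map_ofFun]
  exact Star.map₂_ofFun _ x _ _

/-- Density 1 enters only as a value above 1/2. The numbers `m` and `r` may depend on `ν`, which is
harmless since a single `ν` is used in the end. -/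
theorem IsPointOfDensity.exists_infinite {A : Star M (Set (Fin d → ℤ))}
    {a : Star M (Fin d → ℤ)} (h : IsPointOfDensity A.extent a) :
    ∃ H : Star M ℕ, Infinite H ∧ ∀ ν, Infinite ν → ν < H →
      ∃ (m : ℕ) (r : ℝ), 1 / 2 < r ∧ Star.std M r ≤ starRatio A m a ν := by
  have h1 : ENNReal.ofReal (1 / 2) < densityAt A.extent a := by
    rw [show densityAt A.extent a = 1 from h, ENNReal.ofReal_lt_one]
    norm_num
  rw [densityAt] at h1
  obtain ⟨H, h1⟩ := lt_iSup_iff.1 h1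
  obtain ⟨hH, h1⟩ := lt_iSup_iff.1 h1
  refine ⟨H, hH, fun ν hν hνH => ?_⟩
  have h2 : ENNReal.ofReal (1 / 2) < loeb (starBox a ν).extent (A.extent + stdLattice M d) := by
    rw [extent_starBox]
    exact h1.trans_le (iInf₂_le ν ⟨hν, hνH⟩)
  obtain ⟨m, hm⟩ := exists_lt_loeb_of_subset_iUnion (monotone_extent_starThicken A)
    (extent_add_stdLattice_subset A) h2
  have h3 := hm.trans_le (loeb_le_of_isInternal (isHyperfinite_extent_starBox a ν) ⟨_, rfl⟩
    ⟨_, (Star.extent_map₂_inter _ _).symm⟩)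
  obtain ⟨r, hr, hle⟩ := exists_std_le_of_lt_stdPart (c := 1 / 2) (by norm_num) _
    ((ENNReal.ofReal_lt_ofReal_iff_of_nonneg (by norm_num)).1 h3)
  exact ⟨m, r, hr, hle⟩

theorem exists_infinite_lt_lt {H K : Star M ℕ} (hH : Infinite H) (hK : Infinite K) :
    ∃ ν : Star M ℕ, Infinite ν ∧ ν < H ∧ ν < K := by
  let x : Fin 2 → M := ![H.val, K.val]
  obtain ⟨F, hF⟩ := Star.exists_eq_ofFun x 0 H rfl
  obtain ⟨G, hG⟩ := Star.exists_eq_ofFun x 1 K rfl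
  have hF' (k : ℕ) : ∀ᶠ o in ultrafilterAt x, k < F o := by
    have h := hH k
    rwa [hF, Star.std_eq_ofFun x k, Star.lt_ofFun] at h
  have hG' (k : ℕ) : ∀ᶠ o in ultrafilterAt x, k < G o := by
    have h := hK k
    rwa [hG, Star.std_eq_ofFun x k, Star.lt_ofFun] at h
  -- Subtracting 1 makes both inequalities strict; truncation does not occur, as `F` and `G` are
  -- eventually positive.
  refine ⟨Star.ofFun x fun o => min (F o) (G o) - 1, fun k => ?_, ?_, ?_⟩
  · rw [Star.std_eq_ofFun x k, Star.lt_ofFun]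
    filter_upwards [hF' (k + 1), hG' (k + 1)] with o h1 h2
    omega
  · rw [hF, Star.lt_ofFun]
    filter_upwards [hF' 0] with o h1
    omega
  · rw [hG, Star.lt_ofFun]
    filter_upwards [hG' 0] with o h1
    omega

/-- A common infinite radius at which thickenings of `X` and `Y` by standard boxes have density more
than a half about `a` and `b` gives syndeticity of `X + Y` at `a + b`. -/
theorem isPointOfSyndeticity_of_starRatio {X Y : Star M (Set (Fin d → ℤ))}
    {a b : Star M (Fin d → ℤ)} {ν : Star M ℕ} (hν : Infinite ν) {m k : ℕ} {r s : ℝ}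
    (hr : 1 / 2 < r) (hs : 1 / 2 < s) (hX : Star.std M r ≤ starRatio X m a ν)
    (hY : Star.std M s ≤ starRatio Y k b ν) :
    IsPointOfSyndeticity (X.extent + Y.extent) (a + b) := by
  -- Chosen before `z`: the size of `z` affects only how large the radius must be, and `ν` exceeds
  -- every standard bound.
  refine ⟨m + k, ?_⟩
  rintro _ ⟨_, rfl, _, ⟨z, rfl⟩, rfl⟩
  let x : Fin 5 → M := ![X.val, Y.val, a.val, b.val, ν.val]
  obtain ⟨FX, hFX⟩ := Star.exists_eq_ofFun x 0 X rfl
  obtain ⟨FY, hFY⟩ := Star.exists_eq_ofFun x 1 Y rfl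
  obtain ⟨Fa, hFa⟩ := Star.exists_eq_ofFun x 2 a rfl
  obtain ⟨Fb, hFb⟩ := Star.exists_eq_ofFun x 3 b rfl
  obtain ⟨N, hN⟩ := Star.exists_eq_ofFun x 4 ν rfl
  rw [hFX, hFa, hN, starRatio_ofFun, Star.std_eq_ofFun x r] at hX
  rw [hFY, hFb, hN, starRatio_ofFun, Star.std_eq_ofFun x s] at hY
  replace hX := (Star.rel_ofFun _ x _ _).1 hX
  replace hY := (Star.rel_ofFun _ x _ _).1 hY
  -- An infinite `ν` is represented by a function tending to infinity along the ultrafilter, so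
  -- asymptotic statements about standard boxes apply.
  have htend : Tendsto N (ultrafilterAt x) atTop := by
    refine tendsto_atTop.2 fun j => ?_
    have h := hν j
    rw [hN, Star.std_eq_ofFun x j, Star.lt_ofFun] at h
    exact h.mono fun _ => le_of_lt
  have hmem : ∀ᶠ o in ultrafilterAt x, ∃ w : (Fin d → ℤ) × (Fin d → ℤ) × (Fin d → ℤ),
      w.1 ∈ FX o ∧ w.2.1 ∈ FY o ∧ w.2.2 ∈ box d (m + k) ∧
        Fa o + Fb o + z = w.1 + w.2.1 + w.2.2 := by
    filter_upwards [hX, hY, htend.eventually (eventually_mem_add_of_dense (lt_min hr hs) z)]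
      with o h1 h2 h3
    obtain ⟨_, ⟨p, hp, c, hc, rfl⟩, _, ⟨q, hq, c', hc', rfl⟩, h⟩ :=
      h3 _ _ _ _ ((min_le_left r s).trans h1) ((min_le_right r s).trans h2)
    refine ⟨(p, q, c + c'), hp, hq, add_mem_box hc hc', h.symm.trans ?_⟩
    dsimp only
    abel
  -- Pointwise decompositions, chosen on a set of the ultrafilter, become functions representing the
  -- required points of `X`, `Y` and the cube.
  rw [eventually_iff_exists_mem] at hmem
  obtain ⟨S, hS, hw⟩ := hmem
  choose! w hw using hw
  have hev : ∀ᶠ o in ultrafilterAt x, o ∈ S := hS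
  rw [hFX, hFY, hFa, hFb]
  refine ⟨_, ⟨Star.ofFun x fun o => (w o).1, (Star.ofFun_mem_extent x _ _).2 ?_,
    Star.ofFun x fun o => (w o).2.1, (Star.ofFun_mem_extent x _ _).2 ?_, rfl⟩,
    Star.ofFun x fun o => (w o).2.2, ?_, ?_⟩
  · exact hev.mono fun o ho => (hw o ho).1
  · exact hev.mono fun o ho => (hw o ho).2.1
  · rw [Star.std_eq_ofFun x (m + k), ofFun_mem_cube]
    exact hev.mono fun o ho => (hw o ho).2.2.1
  · dsimp only
    rw [Star.std_eq_ofFun x z]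
    simp only [Star.add_ofFun]
    rw [Star.ofFun_eq_iff]
    exact hev.mono fun o ho => (hw o ho).2.2.2.symm

end Density

end NSA

/-! Saturation is not needed below: only an upper bound for the Loeb measure of a countable union of
internal sets enters, and this follows from continuity from below. -/

theorem mainTheorem8 (M : Type u) [NSA.fullLanguage.Structure M] [NSA.NonstandardExtension M]
    (hsat : NSA.CountablySaturated M) (d : ℕ)
    (X Y : Set (NSA.Star M (Fin d → ℤ))) (hX : NSA.IsInternal X) (hY : NSA.IsInternal Y)
    (a b : NSA.Star M (Fin d → ℤ))
    (ha : NSA.IsPointOfDensity X a) (hb : NSA.IsPointOfDensity Y b) :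
    NSA.IsPointOfSyndeticity (X + Y) (a + b) := by
  obtain ⟨X, rfl⟩ := hX
  obtain ⟨Y, rfl⟩ := hY
  obtain ⟨H, hH, hXd⟩ := ha.exists_infinite
  obtain ⟨K, hK, hYd⟩ := hb.exists_infinite
  obtain ⟨ν, hν, hνH, hνK⟩ := NSA.exists_infinite_lt_lt hH hK
  obtain ⟨m, r, hr, hm⟩ := hXd ν hν hνH
  obtain ⟨k, s, hs, hk⟩ := hYd ν hν hνK
  exact NSA.isPointOfSyndeticity_of_starRatio hν hr hs hm hk
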